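/- Let $k$ be an algebraically closed field and let $C$ be a finite-dimensional $k$-algebra of global dimension at most $2$. For a finite-dimensional $k$-algebra $\Lambda$, let $\operatorname{mod}\Lambda$ be the category of finitely generated right $\Lambda$-modules, $\operatorname{pd}_\Lambda$ the projective dimension, $D=\operatorname{Hom}_k(-,k)$ the standard duality, and $\tau_\Lambda$ the Auslander–Reiten translation of $\operatorname{mod}\Lambda$, that is, $\tau_\Lambda X = D\operatorname{Coker}\bigl(\operatorname{Hom}_\Lambda(P_0,\Lambda)\to\operatorname{Hom}_\Lambda(P_1,\Lambda)\bigr)$ for a minimal projective presentation $P_1\to P_0\to X\to 0$. A module $X\in\operatorname{mod}\Lambda$ is called $\tau_\Lambda$-rigid if $\operatorname{Hom}_\Lambda(X,\tau_\Lambda X)=0$. Let $E$ be the $C$-$C$-bimodule $\operatorname{Ext}^2_C(DC,C)$ and let $B=C\ltimes E$ be the relation extension of $C$, i.e. $B=C\oplus E$ with multiplication $(c,e)(c',e')=(cc',ce'+ec')$; regard $C$ as a subalgebra of $B$ by $c\mapsto(c,0)$. Let $M\in\operatorname{mod}C$. If $M$ is $\tau_C$-rigid and $\operatorname{pd}_C\tau_CM\le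 1$, then the induced $B$-module $M\otimes_CB$ is $\tau_B$-rigid. -/

import Mathlib

open CategoryTheory MulOpposite
open scoped TensorProduct

universe u

/-!
Conventions.  A right module over a ring `A` is a `Module Aᵐᵒᵖ`, with `m · a = op a • m`;
`mod A` is the category of finitely generated right `A`-modules, and `Hom_A(X, Y)` for right
modules is `X →ₗ[Aᵐᵒᵖ] Y`.
-/

namespace TauRigidity

noncomputable section

/-! ### Projective covers -/

section ProjectiveCover

variable {R : Type u} [Ring R]

/-- `f : P → X` is a projective cover: `P` is projective, `f` is surjective, and the kernel of `f`
is superfluous in `P`. -/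
structure IsProjectiveCover {P X : Type u} [AddCommGroup P] [Module R P] [AddCommGroup X]
    [Module R X] (f : P →ₗ[R] X) : Prop where
  projective : Module.Projective R P
  surjective : Function.Surjective f
  superfluous : ∀ L : Submodule R P, LinearMap.ker f ⊔ L = ⊤ → L = ⊤

/-- Over an Artinian ring every finitely generated module has a projective cover. -/
theorem exists_isProjectiveCover [IsArtinianRing R] (X : Type u) [AddCommGroup X] [Module R X]
    [Module.Finite R X] :
    ∃ (P : ModuleCat.{u} R) (f : P →ₗ[R] X), Module.Finite R P ∧ IsProjectiveCover f := by
  obtain ⟨n, f, hf⟩ := Module.Finite.exists_fin' R X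
  let S : Set (Submodule R (Fin n → R)) :=
    {N | Module.Projective R N ∧ Function.Surjective (f.comp N.subtype)}
  have hS : S.Nonempty := by
    refine ⟨⊤, Module.Projective.of_equiv (Submodule.topEquiv (R := R) (M := Fin n → R)).symm, ?_⟩
    intro x
    obtain ⟨y, hy⟩ := hf x
    exact ⟨⟨y, trivial⟩, hy⟩
  obtain ⟨N, hN, hmin⟩ := WellFounded.has_min
    (wellFounded_lt : WellFounded ((· < ·) : Submodule R (Fin n → R) → _ → Prop)) S hS
  obtain ⟨hproj, hsurj⟩ := hN
  refine ⟨ModuleCat.of R N, f.comp N.subtype, inferInstanceAs (Module.Finite R N), hproj, hsurj, ?_⟩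
  intro L hL
  change Submodule R N at L
  have hLs : Function.Surjective ((f.comp N.subtype).comp L.subtype) := by
    intro x
    obtain ⟨y, rfl⟩ := hsurj x
    have hy : y ∈ LinearMap.ker (f.comp N.subtype) ⊔ L := by
      have : LinearMap.ker (f.comp N.subtype) ⊔ L = ⊤ := hL
      rw [this]; trivial
    obtain ⟨a, ha, b, hb, rfl⟩ := Submodule.mem_sup.1 hy
    refine ⟨⟨b, hb⟩, ?_⟩
    have h0 : (f.comp N.subtype) a = 0 := ha
    rw [map_add, h0, zero_add]
    rfl
  obtain ⟨g, hg⟩ := Module.projective_lifting_property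
    ((f.comp N.subtype).comp L.subtype) (f.comp N.subtype) hLs
  let e : Module.End R N := L.subtype.comp g
  have he : ∀ x, (f.comp N.subtype) (e x) = (f.comp N.subtype) x := fun x =>
    LinearMap.congr_fun hg x
  have hem : ∀ (m : ℕ) x, (f.comp N.subtype) ((e ^ m) x) = (f.comp N.subtype) x := by
    intro m
    induction m with
    | zero => intro x; rfl
    | succ m ih => intro x; rw [pow_succ, Module.End.mul_apply, ih, he]
  obtain ⟨m, hm, hm1⟩ :=
    ((e.eventually_isCompl_ker_pow_range_pow).and (Filter.eventually_ge_atTop 1)).exists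
  -- the image of `e ^ m` is a direct summand of `N`
  have hQ : Module.Projective R (LinearMap.range (e ^ m)) :=
    Module.Projective.of_split (LinearMap.range (e ^ m)).subtype
      (Submodule.projectionOnto _ _ hm.symm) (by
        ext x
        simp)
  let Q : Submodule R (Fin n → R) := (LinearMap.range (e ^ m)).map N.subtype
  have hQS : Q ∈ S := by
    refine ⟨Module.Projective.of_equiv
      (Submodule.equivSubtypeMap N (LinearMap.range (e ^ m))), ?_⟩
    intro x
    obtain ⟨y, rfl⟩ := hsurj x
    exact ⟨⟨((e ^ m) y : N), Submodule.mem_map.2 ⟨(e ^ m) y, ⟨y, rfl⟩, rfl⟩⟩, hem m y⟩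
  have hQN : Q ≤ N := Submodule.map_subtype_le _ _
  have hNQ : N ≤ Q := by
    by_contra h
    exact hmin Q hQS (lt_of_le_not_ge hQN h)
  refine eq_top_iff.2 fun y _ => ?_
  obtain ⟨z, ⟨w, rfl⟩, hz⟩ := Submodule.mem_map.1 (hNQ y.2)
  have hz' : (e ^ m) w = y := Subtype.ext hz
  obtain ⟨m', rfl⟩ : ∃ m', m = m' + 1 := ⟨m - 1, by omega⟩
  rw [← hz', pow_succ', Module.End.mul_apply]
  exact (g ((e ^ m') w)).2

variable (R) (X : Type u) [AddCommGroup X] [Module R X] [IsArtinianRing R] [Module.Finite R X]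

/-- The (domain of the) projective cover of a finitely generated module over an Artinian ring. -/
def ProjCover : ModuleCat.{u} R := (exists_isProjectiveCover (R := R) X).choose

/-- The projective cover `P → X`. -/
def projCover : ProjCover R X →ₗ[R] X := (exists_isProjectiveCover (R := R) X).choose_spec.choose

instance : Module.Finite R (ProjCover R X) :=
  (exists_isProjectiveCover (R := R) X).choose_spec.choose_spec.1

theorem projCover_isProjectiveCover : IsProjectiveCover (projCover R X) :=
  (exists_isProjectiveCover (R := R) X).choose_spec.choose_spec.2

/-- `P₁` in the minimal projective presentation `P₁ → P₀ → X → 0`, where `P₀` is the projective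
cover of `X`: the projective cover of the syzygy `ker (P₀ → X)`. -/
def MinPres₁ : ModuleCat.{u} R := ProjCover R (LinearMap.ker (projCover R X))

/-- The map `P₁ → P₀` in the minimal projective presentation of `X`. -/
def minPresMap : MinPres₁ R X →ₗ[R] ProjCover R X :=
  (LinearMap.ker (projCover R X)).subtype.comp (projCover R (LinearMap.ker (projCover R X)))

end ProjectiveCover

/-! ### The standard duality -/

section Duality

/-- The standard dual `D X = Hom_k(X, k)`. -/
def StdDual (k X : Type u) [Field k] [AddCommGroup X] [Module k X] : Type u := X →ₗ[k] k

variable (k : Type u) [Field k] (X : Type u) [AddCommGroup X] [Module k X]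

instance : AddCommGroup (StdDual k X) := inferInstanceAs (AddCommGroup (X →ₗ[k] k))

instance : Module k (StdDual k X) := inferInstanceAs (Module k (X →ₗ[k] k))

/-- The dual of a left `A`-module is a right `A`-module: `(f · a)(x) = f (a x)`. -/
instance {A : Type u} [Ring A] [Algebra k A] [Module A X] [IsScalarTower k A X] :
    Module Aᵐᵒᵖ (StdDual k X) where
  smul a f := LinearMap.comp (show X →ₗ[k] k from f) (Algebra.lsmul k k X (unop a))
  one_smul f := LinearMap.ext fun x => congrArg (show X →ₗ[k] k from f) (one_smul A x)
  mul_smul a b f := LinearMap.ext fun x =>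
    congrArg (show X →ₗ[k] k from f) (mul_smul (unop b) (unop a) x)
  smul_zero _ := rfl
  smul_add _ _ _ := rfl
  add_smul a b f := LinearMap.ext fun x =>
    (congrArg (show X →ₗ[k] k from f) (add_smul (unop a) (unop b) x)).trans
      (map_add (show X →ₗ[k] k from f) _ _)
  zero_smul f := LinearMap.ext fun x =>
    (congrArg (show X →ₗ[k] k from f) (zero_smul A x)).trans (map_zero (show X →ₗ[k] k from f))

end Duality

/-! ### The Auslander–Reiten translation -/

section Translate

variable (k : Type u) [Field k] (A : Type u) [Ring A] [Algebra k A] [FiniteDimensional k A]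

theorem isArtinianRing_op (k : Type u) [Field k] (A : Type u) [Ring A] [Algebra k A]
    [FiniteDimensional k A] : IsArtinianRing Aᵐᵒᵖ := IsArtinianRing.of_finite k Aᵐᵒᵖ

variable (X : Type u) [AddCommGroup X] [Module Aᵐᵒᵖ X] [Module.Finite Aᵐᵒᵖ X]

/-- For a map `d : P → Q` of right `A`-modules, the map of left `A`-modules
`Hom_A(d, A) : Hom_A(Q, A) → Hom_A(P, A)`. -/
def dualMap {A : Type u} [Ring A] {P Q : Type u} [AddCommGroup P] [Module Aᵐᵒᵖ P]
    [AddCommGroup Q] [Module Aᵐᵒᵖ Q] (d : P →ₗ[Aᵐᵒᵖ] Q) :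
    (Q →ₗ[Aᵐᵒᵖ] A) →ₗ[A] (P →ₗ[Aᵐᵒᵖ] A) where
  toFun φ := φ.comp d
  map_add' _ _ := rfl
  map_smul' _ _ := rfl

/-- The transpose `Tr X = coker (Hom_A(P₀, A) → Hom_A(P₁, A))`, a left `A`-module, where
`P₁ → P₀ → X → 0` is the minimal projective presentation of the right `A`-module `X`. -/
abbrev Transpose : Type u :=
  haveI := isArtinianRing_op k A
  (MinPres₁ Aᵐᵒᵖ X →ₗ[Aᵐᵒᵖ] A) ⧸ LinearMap.range (dualMap (minPresMap Aᵐᵒᵖ X))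

/-- The Auslander–Reiten translate `τ_A X = D Tr X`, a right `A`-module. -/
abbrev Tau : Type u := StdDual k (Transpose k A X)

/-- `X` is `τ_A`-rigid: `Hom_A(X, τ_A X) = 0`. -/
def IsTauRigid : Prop := ∀ f : X →ₗ[Aᵐᵒᵖ] Tau k A X, f = 0

end Translate

/-! ### Global dimension -/

/-- The (right) global dimension: the supremum of the projective dimensions of the finitely
generated right modules. -/
def globalDimension (A : Type u) [Ring A] : WithBot ℕ∞ :=
  ⨆ (X : ModuleCat.{u} Aᵐᵒᵖ) (_ : Module.Finite Aᵐᵒᵖ X), projectiveDimension X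

/-! ### Induced modules -/

section Induced

variable {C B : Type u} [Ring C] [Ring B] (φ : C →+* B)
variable (M : Type u) [AddCommGroup M] [Module Cᵐᵒᵖ M]

/-- The right `B`-submodule of `B ⊗_ℤ M` (right action on the factor `B`) spanned by the elements
`(c b) ⊗ m - b ⊗ (m c)`. -/
def balancing : Submodule Bᵐᵒᵖ (B ⊗[ℤ] M) :=
  Submodule.span Bᵐᵒᵖ {t | ∃ (c : C) (b : B) (m : M),
    t = (φ c * b) ⊗ₜ[ℤ] m - b ⊗ₜ[ℤ] (op c • m)}

/-- The induced right `B`-module `M ⊗_C B`, for a ring homomorphism `φ : C → B` through which `B`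
is a left `C`-module.  The class of `b ⊗ₜ m` is the element `m ⊗ b` of `M ⊗_C B`. -/
abbrev Induced : Type u := (B ⊗[ℤ] M) ⧸ balancing φ M

instance [Module.Finite Cᵐᵒᵖ M] : Module.Finite Bᵐᵒᵖ (Induced φ M) := by
  obtain ⟨s, hs⟩ := (Module.Finite.fg_top : (⊤ : Submodule Cᵐᵒᵖ M).FG)
  classical
  refine ⟨⟨s.image fun m => Submodule.Quotient.mk ((1 : B) ⊗ₜ[ℤ] m), ?_⟩⟩
  rw [eq_top_iff]
  set T : Submodule Bᵐᵒᵖ (Induced φ M) :=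
    Submodule.span Bᵐᵒᵖ
      (↑(s.image fun m => (Submodule.Quotient.mk ((1 : B) ⊗ₜ[ℤ] m) : Induced φ M)))
  have key : ∀ m : M, ∀ b : B, (Submodule.Quotient.mk (b ⊗ₜ[ℤ] m) : Induced φ M) ∈ T := by
    intro m
    have hm : m ∈ Submodule.span Cᵐᵒᵖ (s : Set M) := by rw [hs]; trivial
    induction hm using Submodule.span_induction with
    | mem x hx =>
      intro b
      have h1 : (Submodule.Quotient.mk ((1 : B) ⊗ₜ[ℤ] x) : Induced φ M) ∈ T :=
        Submodule.subset_span (by simpa using ⟨x, hx, rfl⟩)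
      have h2 := T.smul_mem (op b) h1
      rw [← Submodule.Quotient.mk_smul, TensorProduct.smul_tmul'] at h2
      simpa using h2
    | zero => intro b; simp
    | add x y _ _ hx hy =>
      intro b
      rw [TensorProduct.tmul_add, Submodule.Quotient.mk_add]
      exact T.add_mem (hx b) (hy b)
    | smul c x _ hx =>
      intro b
      have : (Submodule.Quotient.mk (b ⊗ₜ[ℤ] (c • x)) : Induced φ M) =
          Submodule.Quotient.mk ((φ (unop c) * b) ⊗ₜ[ℤ] x) := by
        symm
        rw [Submodule.Quotient.eq]
        exact Submodule.subset_span ⟨unop c, b, x, rfl⟩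
      rw [this]
      exact hx _
  rintro z -
  obtain ⟨t, rfl⟩ := Submodule.Quotient.mk_surjective _ z
  induction t using TensorProduct.induction_on with
  | zero => simp
  | tmul b m => exact key m b
  | add x y hx hy =>
    rw [Submodule.Quotient.mk_add]
    exact T.add_mem hx hy

end Induced

/-! ### The bimodule `Ext²_C(DC, C)` and the relation extension -/

section RelationExtension

variable (k : Type u) [Field k] (C : Type u) [Ring C] [Algebra k C]

/-- Left multiplication by `c` on the right `C`-module `C`. -/
def leftMulRegular (c : C) : C →ₗ[Cᵐᵒᵖ] C := Module.toModuleEnd Cᵐᵒᵖ C c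

/-- Left multiplication by `c` on the bimodule `D C`, an endomorphism of the right `C`-module `D C`:
`(c · f)(x) = f (x c)`. -/
def leftMulDual (c : C) : StdDual k C →ₗ[Cᵐᵒᵖ] StdDual k C where
  toFun f := LinearMap.comp (show C →ₗ[k] k from f) (LinearMap.mulRight k c)
  map_add' _ _ := rfl
  map_smul' a f := LinearMap.ext fun x =>
    congrArg (show C →ₗ[k] k from f) (mul_assoc (unop a) x c).symm

/-- The group `Ext²_C(DC, C)`, of right `C`-modules. -/
abbrev RelBimodule : Type u :=
  Abelian.Ext (ModuleCat.of Cᵐᵒᵖ (StdDual k C)) (ModuleCat.of Cᵐᵒᵖ C) 2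

/-- The left `C`-action on `Ext²_C(DC, C)`, induced by left multiplication on `C`. -/
instance : Module C (RelBimodule k C) where
  smul c e := Abelian.Ext.comp (Y := ModuleCat.of Cᵐᵒᵖ C) e
    (Abelian.Ext.mk₀ (ModuleCat.ofHom (leftMulRegular C c))) (add_zero 2)
  one_smul e := by
    change Abelian.Ext.comp (Y := ModuleCat.of Cᵐᵒᵖ C) e _ _ = e
    have : ModuleCat.ofHom (leftMulRegular C 1) = 𝟙 (ModuleCat.of Cᵐᵒᵖ C) := by
      ext; simp [leftMulRegular]
    rw [this, Abelian.Ext.comp_mk₀_id]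
  mul_smul a b e := by
    change Abelian.Ext.comp (Y := ModuleCat.of Cᵐᵒᵖ C) e _ _ =
      Abelian.Ext.comp (Y := ModuleCat.of Cᵐᵒᵖ C)
        (Abelian.Ext.comp (Y := ModuleCat.of Cᵐᵒᵖ C) e _ _) _ _
    have : ModuleCat.ofHom (leftMulRegular C (a * b)) =
        ModuleCat.ofHom (leftMulRegular C b) ≫ ModuleCat.ofHom (leftMulRegular C a) := by
      ext; simp [leftMulRegular]
    rw [this, ← Abelian.Ext.mk₀_comp_mk₀, Abelian.Ext.comp_assoc_of_third_deg_zero]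
  smul_zero a := Abelian.Ext.zero_comp _ _ _ _ _
  smul_add a x y := Abelian.Ext.add_comp _ _ _ _
  add_smul a b x := by
    change Abelian.Ext.comp (Y := ModuleCat.of Cᵐᵒᵖ C) x _ _ =
      Abelian.Ext.comp (Y := ModuleCat.of Cᵐᵒᵖ C) x _ _ +
        Abelian.Ext.comp (Y := ModuleCat.of Cᵐᵒᵖ C) x _ _
    have : ModuleCat.ofHom (leftMulRegular C (a + b)) =
        ModuleCat.ofHom (leftMulRegular C a) + ModuleCat.ofHom (leftMulRegular C b) := by
      ext; simp [leftMulRegular]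
    rw [this, Abelian.Ext.mk₀_add, Abelian.Ext.comp_add]
  zero_smul x := by
    change Abelian.Ext.comp (Y := ModuleCat.of Cᵐᵒᵖ C) x _ _ = 0
    have : ModuleCat.ofHom (leftMulRegular C 0) = 0 := by
      ext; simp [leftMulRegular]
    rw [this, Abelian.Ext.mk₀_zero, Abelian.Ext.comp_zero]

/-- The right `C`-action on `Ext²_C(DC, C)`, induced by left multiplication on `D C`. -/
instance : Module Cᵐᵒᵖ (RelBimodule k C) where
  smul c e := Abelian.Ext.comp (Y := ModuleCat.of Cᵐᵒᵖ (StdDual k C))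
    (Abelian.Ext.mk₀ (ModuleCat.ofHom (leftMulDual k C (unop c)))) e (zero_add 2)
  one_smul e := by
    change Abelian.Ext.comp (Y := ModuleCat.of Cᵐᵒᵖ (StdDual k C)) _ e _ = e
    have : ModuleCat.ofHom (leftMulDual k C (unop 1)) = 𝟙 (ModuleCat.of Cᵐᵒᵖ (StdDual k C)) := by
      ext f
      exact LinearMap.ext fun x => congrArg (show C →ₗ[k] k from f) (mul_one x)
    rw [this, Abelian.Ext.mk₀_id_comp]
  mul_smul a b e := by
    change Abelian.Ext.comp (Y := ModuleCat.of Cᵐᵒᵖ (StdDual k C)) _ e _ =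
      Abelian.Ext.comp (Y := ModuleCat.of Cᵐᵒᵖ (StdDual k C)) _
        (Abelian.Ext.comp (Y := ModuleCat.of Cᵐᵒᵖ (StdDual k C)) _ e _) _
    have : ModuleCat.ofHom (leftMulDual k C (unop (a * b))) =
        ModuleCat.ofHom (leftMulDual k C (unop a)) ≫ ModuleCat.ofHom (leftMulDual k C (unop b)) := by
      ext f
      exact LinearMap.ext fun x =>
        congrArg (show C →ₗ[k] k from f) (mul_assoc x (unop b) (unop a)).symm
    rw [this, Abelian.Ext.mk₀_comp_mk₀_assoc]
  smul_zero a := Abelian.Ext.comp_zero _ _ _ _ _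
  smul_add a x y := Abelian.Ext.comp_add _ _ _ _
  add_smul a b x := by
    change Abelian.Ext.comp (Y := ModuleCat.of Cᵐᵒᵖ (StdDual k C)) _ x _ =
      Abelian.Ext.comp (Y := ModuleCat.of Cᵐᵒᵖ (StdDual k C)) _ x _ +
        Abelian.Ext.comp (Y := ModuleCat.of Cᵐᵒᵖ (StdDual k C)) _ x _
    have : ModuleCat.ofHom (leftMulDual k C (unop (a + b))) =
        ModuleCat.ofHom (leftMulDual k C (unop a)) + ModuleCat.ofHom (leftMulDual k C (unop b)) := by
      ext f
      exact LinearMap.ext fun x =>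
        (congrArg (show C →ₗ[k] k from f) (mul_add x (unop a) (unop b))).trans
          (map_add (show C →ₗ[k] k from f) _ _)
    rw [this, Abelian.Ext.mk₀_add, Abelian.Ext.add_comp]
  zero_smul x := by
    change Abelian.Ext.comp (Y := ModuleCat.of Cᵐᵒᵖ (StdDual k C)) _ x _ = 0
    have : ModuleCat.ofHom (leftMulDual k C (unop 0)) = 0 := by
      ext f
      exact LinearMap.ext fun x =>
        (congrArg (show C →ₗ[k] k from f) (mul_zero x)).trans (map_zero (show C →ₗ[k] k from f))
    rw [this, Abelian.Ext.mk₀_zero, Abelian.Ext.zero_comp]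

instance : SMulCommClass C Cᵐᵒᵖ (RelBimodule k C) where
  smul_comm _ _ _ := Abelian.Ext.comp_assoc_of_third_deg_zero _ _ _ _

instance : IsScalarTower k C (RelBimodule k C) where
  smul_assoc r c e := by
    change Abelian.Ext.comp (Y := ModuleCat.of Cᵐᵒᵖ C) e _ _ =
      r • Abelian.Ext.comp (Y := ModuleCat.of Cᵐᵒᵖ C) e _ _
    have : ModuleCat.ofHom (leftMulRegular C (r • c)) =
        (Linear.homModule (R := k) _ _).toSMul.smul r (ModuleCat.ofHom (leftMulRegular C c)) := by
      refine ModuleCat.hom_ext (LinearMap.ext fun x => ?_)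
      change (r • c) * x = (c * x) * algebraMap k C r
      rw [smul_mul_assoc, Algebra.smul_def, Algebra.commutes]
    rw [this]
    exact (congrArg (fun t => Abelian.Ext.comp (Y := ModuleCat.of Cᵐᵒᵖ C) e t _)
      (Abelian.Ext.mk₀_smul r _)).trans (Abelian.Ext.comp_smul _ _ _ r)

instance : IsScalarTower k Cᵐᵒᵖ (RelBimodule k C) where
  smul_assoc r c e := by
    change Abelian.Ext.comp (Y := ModuleCat.of Cᵐᵒᵖ (StdDual k C)) _ e _ =
      r • Abelian.Ext.comp (Y := ModuleCat.of Cᵐᵒᵖ (StdDual k C)) _ e _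
    have : ModuleCat.ofHom (leftMulDual k C (unop (r • c))) =
        r • ModuleCat.ofHom (leftMulDual k C (unop c)) := by
      ext f
      refine LinearMap.ext fun x => congrArg (show C →ₗ[k] k from f) ?_
      change x * (r • unop c) = (algebraMap k C r * x) * unop c
      rw [mul_smul_comm, Algebra.smul_def, mul_assoc]
    rw [this, Abelian.Ext.mk₀_smul, Abelian.Ext.smul_comp]

/-- The relation extension `B = C ⋉ Ext²_C(DC, C)`: the trivial extension, with multiplication
`(c, e) (c', e') = (c c', c e' + e c')`. -/
abbrev RelationExtension : Type u := TrivSqZeroExt C (RelBimodule k C)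

open scoped ModuleCat in
/-- `Ext` groups of finitely generated modules over a finite-dimensional algebra are
finite-dimensional. -/
theorem finite_ext_of_algebra {A : Type u} [Ring A] [Algebra k A] [FiniteDimensional k A]
    (X Y : ModuleCat.{u} A) [Module.Finite A X] [Module.Finite A Y] (i : ℕ) :
    Module.Finite k (Abelian.Ext X Y i) := by
  have : IsNoetherianRing A := IsNoetherianRing.of_finite k A
  have : Module.Finite k Y := Module.Finite.trans A Y
  induction i generalizing X with
  | zero =>
    obtain ⟨n, f, hf⟩ := Module.Finite.exists_fin' A X
    let ev : (X ⟶ Y) →ₗ[k] (Fin n → Y) :=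
      { toFun g j := g.hom (f (Pi.single j 1))
        map_add' _ _ := rfl
        map_smul' _ _ := rfl }
    have hev : Function.Injective ev := by
      intro g h hgh
      have h1 : g.hom.comp f = h.hom.comp f :=
        LinearMap.pi_ext' fun j => LinearMap.ext_ring (congrFun hgh j)
      ext x
      obtain ⟨y, rfl⟩ := hf x
      exact LinearMap.congr_fun h1 y
    have : Module.Finite k (X ⟶ Y) := Module.Finite.of_injective ev hev
    exact Module.Finite.equiv (Abelian.Ext.linearEquiv₀ (R := k)).symm
  | succ n ih =>
    obtain ⟨m, f, hf⟩ := Module.Finite.exists_fin' A X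
    let exac := LinearMap.shortExact_shortComplexKer hf
    have : Projective (LinearMap.shortComplexKer f).X₂ :=
      inferInstanceAs (Projective (ModuleCat.of A (Fin m → A)))
    have : Module.Finite A (LinearMap.shortComplexKer f).X₁ :=
      inferInstanceAs (Module.Finite A (LinearMap.ker f))
    have := ih (LinearMap.shortComplexKer f).X₁
    exact Module.Finite.of_surjective (exac.extClass.precompOfLinear k Y (add_comm 1 n))
      (precomp_extClass_surjective_of_projective_X₂ Y exac n)

instance [FiniteDimensional k C] : FiniteDimensional k (RelBimodule k C) := by
  have : Module.Finite Cᵐᵒᵖ (StdDual k C) := by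
    have : IsScalarTower k Cᵐᵒᵖ (StdDual k C) := ⟨fun r c f => LinearMap.ext fun x => by
      change (show C →ₗ[k] k from f) ((r • unop c) * x) =
        r • (show C →ₗ[k] k from f) (unop c * x)
      rw [smul_mul_assoc, map_smul]⟩
    have : Module.Finite k (StdDual k C) := inferInstanceAs (Module.Finite k (C →ₗ[k] k))
    exact Module.Finite.of_restrictScalars_finite k _ _
  have : Module.Finite Cᵐᵒᵖ (ModuleCat.of Cᵐᵒᵖ (StdDual k C)) := this
  have : Module.Finite Cᵐᵒᵖ (ModuleCat.of Cᵐᵒᵖ C) := 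
    Module.Finite.of_restrictScalars_finite k Cᵐᵒᵖ C
  exact finite_ext_of_algebra k (ModuleCat.of Cᵐᵒᵖ (StdDual k C)) (ModuleCat.of Cᵐᵒᵖ C) 2

instance [FiniteDimensional k C] : FiniteDimensional k (RelationExtension k C) :=
  inferInstanceAs (Module.Finite k (C × RelBimodule k C))

end RelationExtension

end

end TauRigidity

namespace TauRigidity

/-! ### Modules with the extension property along a map -/

section Extends

variable {R : Type*} [Ring R] {P Q : Type*} [AddCommGroup P] [Module R P] [AddCommGroup Q]
  [Module R Q]

/-- Every map `P → Y` factors through `d : P → Q`. -/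
def ExtendsAlong (d : P →ₗ[R] Q) (Y : Type*) [AddCommGroup Y] [Module R Y] : Prop :=
  ∀ u : P →ₗ[R] Y, ∃ v : Q →ₗ[R] Y, v.comp d = u

variable {d : P →ₗ[R] Q}

theorem ExtendsAlong.pi {ι : Type*} {Y : ι → Type*} [∀ i, AddCommGroup (Y i)]
    [∀ i, Module R (Y i)] (h : ∀ i, ExtendsAlong d (Y i)) : ExtendsAlong d (∀ i, Y i) := by
  intro u
  choose v hv using fun i => h i ((LinearMap.proj i).comp u)
  refine ⟨LinearMap.pi v, LinearMap.ext fun p => funext fun i => ?_⟩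
  exact LinearMap.congr_fun (hv i) p

theorem ExtendsAlong.prod {Y Z : Type*} [AddCommGroup Y] [Module R Y] [AddCommGroup Z]
    [Module R Z] (hY : ExtendsAlong d Y) (hZ : ExtendsAlong d Z) : ExtendsAlong d (Y × Z) := by
  intro u
  obtain ⟨v, hv⟩ := hY ((LinearMap.fst R Y Z).comp u)
  obtain ⟨w, hw⟩ := hZ ((LinearMap.snd R Y Z).comp u)
  refine ⟨v.prod w, LinearMap.ext fun p => Prod.ext ?_ ?_⟩
  · exact LinearMap.congr_fun hv p
  · exact LinearMap.congr_fun hw p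

theorem ExtendsAlong.of_surjective [Module.Projective R P] {Y Z : Type*} [AddCommGroup Y]
    [Module R Y] [AddCommGroup Z] [Module R Z] (hY : ExtendsAlong d Y) (f : Y →ₗ[R] Z)
    (hf : Function.Surjective f) : ExtendsAlong d Z := by
  intro u
  obtain ⟨u', rfl⟩ := Module.projective_lifting_property f u hf
  obtain ⟨v, rfl⟩ := hY u'
  exact ⟨f.comp v, rfl⟩

end Extends

/-! ### The Auslander–Reiten formula -/

section Formula

variable {A : Type*} [Ring A] {P Y : Type*} [AddCommGroup P] [Module Aᵐᵒᵖ P]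
  [AddCommGroup Y] [Module Aᵐᵒᵖ Y]

/-- The map `p ↦ y · φ(p)` of right `A`-modules. -/
def rankOne (y : Y) (φ : P →ₗ[Aᵐᵒᵖ] A) : P →ₗ[Aᵐᵒᵖ] Y where
  toFun p := op (φ p) • y
  map_add' p q := by rw [map_add, ← add_smul]; rfl
  map_smul' a p := by
    rw [map_smul, RingHom.id_apply, smul_smul]
    rfl

theorem rankOne_apply (y : Y) (φ : P →ₗ[Aᵐᵒᵖ] A) (p : P) : rankOne y φ p = op (φ p) • y := rfl

theorem exists_dualBasis (P : Type*) [AddCommGroup P] [Module Aᵐᵒᵖ P] [Module.Finite Aᵐᵒᵖ P]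
    [Module.Projective Aᵐᵒᵖ P] :
    ∃ (n : ℕ) (p : Fin n → P) (φ : Fin n → (P →ₗ[Aᵐᵒᵖ] A)), ∀ x, x = ∑ i, op (φ i x) • p i := by
  obtain ⟨n, f, g, -, -, hfg⟩ := Module.Finite.exists_comp_eq_id_of_projective Aᵐᵒᵖ P
  let e : Aᵐᵒᵖ →ₗ[Aᵐᵒᵖ] A :=
    { toFun := unop
      map_add' := fun _ _ => rfl
      map_smul' := fun _ _ => rfl }
  refine ⟨n, fun i => f (Pi.single i 1), fun i => e.comp ((LinearMap.proj i).comp g), fun x => ?_⟩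
  conv_lhs => rw [← LinearMap.id_apply (R := Aᵐᵒᵖ) x, ← hfg, LinearMap.comp_apply,
    pi_eq_sum_univ' (g x), map_sum]
  refine Finset.sum_congr rfl fun i _ => ?_
  rw [← map_smul]
  congr 1

theorem eq_sum_rankOne {n : ℕ} {p : Fin n → P} {φ : Fin n → (P →ₗ[Aᵐᵒᵖ] A)}
    (h : ∀ x, x = ∑ i, op (φ i x) • p i) (u : P →ₗ[Aᵐᵒᵖ] Y) :
    u = ∑ i, rankOne (u (p i)) (φ i) := by
  ext x
  conv_lhs => rw [h x]
  simp [rankOne_apply]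

theorem eq_sum_smul {n : ℕ} {p : Fin n → P} {φ : Fin n → (P →ₗ[Aᵐᵒᵖ] A)}
    (h : ∀ x, x = ∑ i, op (φ i x) • p i) (χ : P →ₗ[Aᵐᵒᵖ] A) : χ = ∑ i, χ (p i) • φ i := by
  ext x
  conv_lhs => rw [h x, map_sum]
  rw [LinearMap.sum_apply]
  exact Finset.sum_congr rfl fun i _ => by rw [map_smul]; rfl

end Formula

section FormulaDual

variable (k : Type u) [Field k] {A : Type u} [Ring A] [Algebra k A]
  {P Q Y : Type u} [AddCommGroup P] [Module Aᵐᵒᵖ P] [AddCommGroup Q] [Module Aᵐᵒᵖ Q]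
  [AddCommGroup Y] [Module Aᵐᵒᵖ Y] (d : P →ₗ[Aᵐᵒᵖ] Q)

theorem ExtendsAlong.of_hom_eq_zero [Module.Finite Aᵐᵒᵖ P] [Module.Projective Aᵐᵒᵖ P]
    (h : ∀ f : Y →ₗ[Aᵐᵒᵖ] StdDual k ((P →ₗ[Aᵐᵒᵖ] A) ⧸ LinearMap.range (dualMap d)), f = 0) :
    ExtendsAlong d Y := by
  intro u
  let _ : Module k Y := Module.compHom Y (algebraMap k Aᵐᵒᵖ)
  have : IsScalarTower k Aᵐᵒᵖ Y := ⟨fun r a y => by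
    rw [Algebra.smul_def, mul_smul]; rfl⟩
  have : SMulCommClass Aᵐᵒᵖ k Y := IsScalarTower.to_smulCommClass'
  let S : Submodule k (P →ₗ[Aᵐᵒᵖ] Y) :=
    { carrier := {u | ∃ v : Q →ₗ[Aᵐᵒᵖ] Y, v.comp d = u}
      add_mem' := by
        rintro _ _ ⟨v, rfl⟩ ⟨w, rfl⟩
        exact ⟨v + w, rfl⟩
      zero_mem' := ⟨0, rfl⟩
      smul_mem' := by
        rintro r _ ⟨v, rfl⟩
        exact ⟨r • v, rfl⟩ }
  by_contra hu
  obtain ⟨ξ, hξu, hξ⟩ := Submodule.exists_le_ker_of_notMem (show u ∉ S from hu)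
  have hsmul : ∀ (r : k) (y : Y) (φ : P →ₗ[Aᵐᵒᵖ] A), rankOne y (r • φ) = r • rankOne y φ := by
    intro r y φ
    ext p
    change op (r • φ p) • y = r • op (φ p) • y
    rw [op_smul, smul_assoc]
  let F (y : Y) : (P →ₗ[Aᵐᵒᵖ] A) →ₗ[k] k :=
    { toFun := fun φ => ξ (rankOne y φ)
      map_add' := fun φ ψ => by
        rw [← map_add]
        congr 1
        ext p
        simp [rankOne_apply, add_smul]
      map_smul' := fun r φ => by rw [hsmul, map_smul]; rfl }
  have hF : ∀ y, ∀ φ ∈ LinearMap.range (dualMap (A := A) d), F y φ = 0 := by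
    rintro y _ ⟨ψ, rfl⟩
    exact hξ ⟨rankOne y ψ, rfl⟩
  let f : Y →ₗ[Aᵐᵒᵖ] StdDual k ((P →ₗ[Aᵐᵒᵖ] A) ⧸ LinearMap.range (dualMap d)) :=
    { toFun := fun y => Submodule.liftQ ((LinearMap.range (dualMap d)).restrictScalars k) (F y)
        (hF y)
      map_add' := fun y z => by
        refine LinearMap.ext fun t => ?_
        obtain ⟨φ, rfl⟩ := Submodule.Quotient.mk_surjective _ t
        change ξ _ = ξ _ + ξ _
        rw [← map_add]
        congr 1
        ext p
        simp [rankOne_apply]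
      map_smul' := fun a y => by
        refine LinearMap.ext fun t => ?_
        obtain ⟨φ, rfl⟩ := Submodule.Quotient.mk_surjective _ t
        change ξ _ = ξ _
        congr 1
        ext p
        change op (φ p) • a • y = op (unop a * φ p) • y
        rw [smul_smul]
        rfl }
  have hξ0 : ∀ y φ, ξ (rankOne y φ) = 0 := fun y φ =>
    LinearMap.congr_fun (LinearMap.congr_fun (h f) y) (Submodule.Quotient.mk φ)
  obtain ⟨n, p, φ, hp⟩ := exists_dualBasis (A := A) P
  apply hξu
  rw [eq_sum_rankOne hp u, map_sum]
  exact Finset.sum_eq_zero fun i _ => hξ0 _ _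

theorem ExtendsAlong.hom_eq_zero [Module.Finite Aᵐᵒᵖ P] [Module.Projective Aᵐᵒᵖ P]
    [Module.Finite Aᵐᵒᵖ Q] [Module.Projective Aᵐᵒᵖ Q] (h : ExtendsAlong d Y)
    (f : Y →ₗ[Aᵐᵒᵖ] StdDual k ((P →ₗ[Aᵐᵒᵖ] A) ⧸ LinearMap.range (dualMap d))) : f = 0 := by
  obtain ⟨n, p, φ, hp⟩ := exists_dualBasis (A := A) P
  obtain ⟨m, q, ψ, hq⟩ := exists_dualBasis (A := A) Q
  let F (y : Y) (χ : P →ₗ[Aᵐᵒᵖ] A) : k :=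
    (show ((P →ₗ[Aᵐᵒᵖ] A) ⧸ LinearMap.range (dualMap d)) →ₗ[k] k from f y)
      (Submodule.Quotient.mk χ)
  have hFz : ∀ χ, F 0 χ = 0 := fun χ => by
    change (show ((P →ₗ[Aᵐᵒᵖ] A) ⧸ LinearMap.range (dualMap d)) →ₗ[k] k from f 0) _ = 0
    rw [map_zero]; rfl
  have hFadd : ∀ y z χ, F (y + z) χ = F y χ + F z χ := fun y z χ => by
    change (show ((P →ₗ[Aᵐᵒᵖ] A) ⧸ LinearMap.range (dualMap d)) →ₗ[k] k from f (y + z)) _ = _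
    rw [map_add]; rfl
  have hFsmul : ∀ (a : A) y χ, F (op a • y) χ = F y (a • χ) := fun a y χ => by
    change (show ((P →ₗ[Aᵐᵒᵖ] A) ⧸ LinearMap.range (dualMap d)) →ₗ[k] k from f (op a • y)) _ = _
    rw [map_smul]; rfl
  have hFsum : ∀ y (s : Fin n → (P →ₗ[Aᵐᵒᵖ] A)), F y (∑ i, s i) = ∑ i, F y (s i) := by
    intro y s
    change (show ((P →ₗ[Aᵐᵒᵖ] A) ⧸ LinearMap.range (dualMap d)) →ₗ[k] k from f y)
      (Submodule.mkQ _ _) = _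
    rw [map_sum, map_sum]; rfl
  let ξ (u : P →ₗ[Aᵐᵒᵖ] Y) : k := ∑ i, F (u (p i)) (φ i)
  have hξ : ∀ y χ, ξ (rankOne y χ) = F y χ := by
    intro y χ
    conv_rhs => rw [eq_sum_smul hp χ, hFsum]
    exact Finset.sum_congr rfl fun i _ => hFsmul _ _ _
  have hξ0 : ξ 0 = 0 := Finset.sum_eq_zero fun i _ => hFz _
  have hξadd : ∀ u v, ξ (u + v) = ξ u + ξ v := fun u v => by
    rw [← Finset.sum_add_distrib]
    exact Finset.sum_congr rfl fun i _ => hFadd _ _ _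
  let ξ' : (P →ₗ[Aᵐᵒᵖ] Y) →+ k := ⟨⟨ξ, hξ0⟩, hξadd⟩
  have hξd : ∀ v : Q →ₗ[Aᵐᵒᵖ] Y, ξ (v.comp d) = 0 := by
    intro v
    have : v.comp d = ∑ j, rankOne (v (q j)) ((ψ j).comp d) := by
      conv_lhs => rw [eq_sum_rankOne hq v]
      ext x
      simp [rankOne_apply]
    rw [this]
    change ξ' _ = 0
    rw [map_sum]
    refine Finset.sum_eq_zero fun j _ => ?_
    change ξ _ = 0
    rw [hξ]
    have : (Submodule.Quotient.mk ((ψ j).comp d) :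
        (P →ₗ[Aᵐᵒᵖ] A) ⧸ LinearMap.range (dualMap d)) = 0 :=
      (Submodule.Quotient.mk_eq_zero _).2 ⟨ψ j, rfl⟩
    change (show ((P →ₗ[Aᵐᵒᵖ] A) ⧸ LinearMap.range (dualMap d)) →ₗ[k] k from _) _ = 0
    rw [this, map_zero]
  refine LinearMap.ext fun y => LinearMap.ext fun t => ?_
  obtain ⟨χ, rfl⟩ := Submodule.Quotient.mk_surjective _ t
  change F y χ = 0
  obtain ⟨v, hv⟩ := h (rankOne y χ)
  rw [← hξ, ← hv, hξd]

end FormulaDual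

/-! ### Comparison with the minimal projective presentation -/

section Minimal

variable {R : Type u} [Ring R] {P X : Type u} [AddCommGroup P] [Module R P] [AddCommGroup X]
    [Module R X]

theorem IsProjectiveCover.bijective_of_comp_eq [IsNoetherian R P] {f : P →ₗ[R] X}
    (hf : IsProjectiveCover f) {g : P →ₗ[R] P} (hg : f.comp g = f) : Function.Bijective g := by
  have hs : Function.Surjective g := by
    rw [← LinearMap.range_eq_top]
    refine hf.superfluous _ (eq_top_iff.2 fun x _ => ?_)
    rw [← sub_add_cancel x (g x)]
    refine Submodule.add_mem_sup ?_ ⟨x, rfl⟩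
    rw [LinearMap.mem_ker, map_sub, sub_eq_zero]
    exact (LinearMap.congr_fun hg x).symm
  exact ⟨IsNoetherian.injective_of_surjective_endomorphism g hs, hs⟩

theorem IsProjectiveCover.exists_section [IsNoetherian R P] {f : P →ₗ[R] X}
    (hf : IsProjectiveCover f) {Q : Type*} [AddCommGroup Q] [Module R Q] [Module.Projective R Q]
    {ε : Q →ₗ[R] X} {a : P →ₗ[R] Q} (ha : ε.comp a = f) :
    ∃ b : Q →ₗ[R] P, f.comp b = ε ∧ b.comp a = LinearMap.id := by
  obtain ⟨b, hb⟩ := Module.projective_lifting_property f ε hf.surjective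
  let θ := LinearEquiv.ofBijective (b.comp a)
    (hf.bijective_of_comp_eq (by rw [← LinearMap.comp_assoc, hb, ha]))
  have hθ : ∀ x, f (θ x) = f x := fun x =>
    (LinearMap.congr_fun hb (a x)).trans (LinearMap.congr_fun ha x)
  refine ⟨θ.symm.toLinearMap.comp b, LinearMap.ext fun x => ?_, LinearMap.ext fun x => ?_⟩
  · change f (θ.symm (b x)) = _
    rw [← hθ, LinearEquiv.apply_symm_apply]
    exact LinearMap.congr_fun hb x
  · exact θ.symm_apply_apply x

theorem exists_comp_eq_of_range_le {Q₀ Q₁ : Type*} [AddCommGroup Q₀] [Module R Q₀]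
    [AddCommGroup Q₁] [Module R Q₁] [Module.Projective R P]
    {δ : Q₁ →ₗ[R] Q₀} (g : P →ₗ[R] Q₀) (hg : LinearMap.range g ≤ LinearMap.range δ) :
    ∃ a : P →ₗ[R] Q₁, δ.comp a = g := by
  obtain ⟨a, ha⟩ := Module.projective_lifting_property δ.rangeRestrict
    (g.codRestrict (LinearMap.range δ) fun x => hg ⟨x, rfl⟩) δ.surjective_rangeRestrict
  exact ⟨a, LinearMap.ext fun x => congrArg Subtype.val (LinearMap.congr_fun ha x)⟩

/-- If `Y` extends along some projective presentation of `X`, it extends along each presentation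
by projective covers. -/
theorem ExtendsAlong.of_isProjectiveCover {P₀ P₁ : Type u} [AddCommGroup P₀] [Module R P₀]
    [AddCommGroup P₁] [Module R P₁] [IsNoetherian R P₀] [IsNoetherian R P₁] {f₀ : P₀ →ₗ[R] X}
    (h₀ : IsProjectiveCover f₀) {f₁ : P₁ →ₗ[R] LinearMap.ker f₀} (h₁ : IsProjectiveCover f₁)
    {Q₀ Q₁ Y : Type*} [AddCommGroup Q₀] [Module R Q₀] [AddCommGroup Q₁] [Module R Q₁]
    [AddCommGroup Y] [Module R Y] [Module.Projective R Q₀] [Module.Projective R Q₁]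
    {δ : Q₁ →ₗ[R] Q₀} {ε : Q₀ →ₗ[R] X} (hε : Function.Surjective ε)
    (hδ : LinearMap.range δ = LinearMap.ker ε) (h : ExtendsAlong δ Y) :
    ExtendsAlong ((LinearMap.ker f₀).subtype.comp f₁) Y := by
  have : Module.Projective R P₀ := h₀.projective
  have : Module.Projective R P₁ := h₁.projective
  obtain ⟨a₀, ha₀⟩ := Module.projective_lifting_property ε f₀ hε
  obtain ⟨b₀, hb₀, hba₀⟩ := h₀.exists_section ha₀
  obtain ⟨a₁, ha₁⟩ := exists_comp_eq_of_range_le (δ := δ)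
      (a₀.comp ((LinearMap.ker f₀).subtype.comp f₁)) (by
    rw [hδ]
    rintro _ ⟨x, rfl⟩
    exact (LinearMap.congr_fun ha₀ _).trans (f₁ x).2)
  have hb : ∀ x, b₀ (δ x) ∈ LinearMap.ker f₀ := fun x => by
    rw [LinearMap.mem_ker, ← LinearMap.comp_apply, hb₀, ← LinearMap.mem_ker, ← hδ]
    exact ⟨x, rfl⟩
  obtain ⟨b₁, -, hba₁⟩ := h₁.exists_section (Q := Q₁)
    (ε := (b₀.comp δ).codRestrict (LinearMap.ker f₀) hb) (a := a₁) (by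
      refine LinearMap.ext fun x => Subtype.ext ?_
      exact (congrArg b₀ (LinearMap.congr_fun ha₁ x)).trans (LinearMap.congr_fun hba₀ _))
  intro u
  obtain ⟨v, hv⟩ := h (u.comp b₁)
  refine ⟨v.comp a₀, ?_⟩
  rw [LinearMap.comp_assoc, ← ha₁, ← LinearMap.comp_assoc, hv, LinearMap.comp_assoc, hba₁,
    LinearMap.comp_id]

section Instances

variable [IsArtinianRing R] [Module.Finite R X]

instance : Module.Projective R (ProjCover R X) := (projCover_isProjectiveCover R X).projective

instance : Module.Finite R (MinPres₁ R X) :=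
  inferInstanceAs (Module.Finite R (ProjCover R (LinearMap.ker (projCover R X))))

instance : Module.Projective R (MinPres₁ R X) :=
  inferInstanceAs (Module.Projective R (ProjCover R (LinearMap.ker (projCover R X))))

end Instances

theorem ExtendsAlong.minPresMap [IsArtinianRing R] [Module.Finite R X] {Q₀ Q₁ Y : Type*}
    [AddCommGroup Q₀] [Module R Q₀] [AddCommGroup Q₁] [Module R Q₁] [AddCommGroup Y] [Module R Y]
    [Module.Projective R Q₀] [Module.Projective R Q₁] {δ : Q₁ →ₗ[R] Q₀} {ε : Q₀ →ₗ[R] X}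
    (hε : Function.Surjective ε) (hδ : LinearMap.range δ = LinearMap.ker ε)
    (h : ExtendsAlong δ Y) : ExtendsAlong (minPresMap R X) Y :=
  h.of_isProjectiveCover (projCover_isProjectiveCover R X)
    (projCover_isProjectiveCover R (LinearMap.ker (projCover R X))) hε hδ

theorem range_minPresMap [IsArtinianRing R] [Module.Finite R X] :
    LinearMap.range (minPresMap R X) = LinearMap.ker (projCover R X) := by
  ext x
  constructor
  · rintro ⟨y, rfl⟩
    exact (projCover R (LinearMap.ker (projCover R X)) y).2
  · intro hx
    obtain ⟨y, hy⟩ := (projCover_isProjectiveCover R (LinearMap.ker (projCover R X))).surjective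
      ⟨x, hx⟩
    exact ⟨y, congrArg Subtype.val hy⟩

end Minimal

/-! ### Induction along a ring homomorphism -/

section Semilinear

variable {R S : Type*} [Ring R] [Ring S] {σ : R →+* S}

theorem exists_semilinear_lift {P F Z : Type*} [AddCommGroup P] [Module R P]
    [Module.Projective R P] [AddCommGroup F] [Module S F] [AddCommGroup Z] [Module S Z]
    (f : F →ₗ[S] Z) (hf : Function.Surjective f) (u : P →ₛₗ[σ] Z) :
    ∃ v : P →ₛₗ[σ] F, f.comp v = u := by
  let _ : Module R F := Module.compHom F σ
  let _ : Module R Z := Module.compHom Z σ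
  let f' : F →ₗ[R] Z := ⟨⟨f, map_add f⟩, fun r x => map_smul f (σ r) x⟩
  let u' : P →ₗ[R] Z := ⟨⟨u, map_add u⟩, fun r x => map_smulₛₗ u r x⟩
  obtain ⟨v, hv⟩ := Module.projective_lifting_property f' u' hf
  exact ⟨⟨⟨v, map_add v⟩, fun r x => map_smul v r x⟩,
    LinearMap.ext fun x => LinearMap.congr_fun hv x⟩

theorem exists_lift_of_semilinear {P F Z : Type*} [AddCommGroup P] [Module R P]
    [Module.Projective R P] [AddCommGroup F] [Module R F] [AddCommGroup Z] [Module S Z]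
    (f : F →ₛₗ[σ] Z) (hf : Function.Surjective f) (u : P →ₛₗ[σ] Z) :
    ∃ v : P →ₗ[R] F, f.comp v = u := by
  let _ : Module R Z := Module.compHom Z σ
  let f' : F →ₗ[R] Z := ⟨⟨f, map_add f⟩, fun r x => map_smulₛₗ f r x⟩
  let u' : P →ₗ[R] Z := ⟨⟨u, map_add u⟩, fun r x => map_smulₛₗ u r x⟩
  obtain ⟨v, hv⟩ := Module.projective_lifting_property f' u' hf
  exact ⟨v, LinearMap.ext fun x => LinearMap.congr_fun hv x⟩

end Semilinear

section Induction

variable {C B : Type u} [Ring C] [Ring B] (φ : C →+* B)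
variable {M N P : Type u} [AddCommGroup M] [Module Cᵐᵒᵖ M] [AddCommGroup N] [Module Cᵐᵒᵖ N]
  [AddCommGroup P] [Module Cᵐᵒᵖ P]

theorem induced_mk_smul (c : C) (b : B) (m : M) :
    (Submodule.Quotient.mk (b ⊗ₜ[ℤ] (op c • m)) : Induced φ M) =
      Submodule.Quotient.mk ((φ c * b) ⊗ₜ[ℤ] m) := by
  symm
  rw [Submodule.Quotient.eq]
  exact Submodule.subset_span ⟨c, b, m, rfl⟩

variable (M) in
/-- The unit `m ↦ m ⊗ 1` of the induction-restriction adjunction. -/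
noncomputable def inducedUnit : M →ₛₗ[RingHom.op φ] Induced φ M where
  toFun m := Submodule.Quotient.mk ((1 : B) ⊗ₜ[ℤ] m)
  map_add' m m' := by rw [TensorProduct.tmul_add, Submodule.Quotient.mk_add]
  map_smul' c m := by
    have h := induced_mk_smul φ (unop c) 1 m
    rw [op_unop] at h
    rw [h, ← Submodule.Quotient.mk_smul, TensorProduct.smul_tmul']
    simp

theorem induced_mk_eq_smul (b : B) (m : M) :
    (Submodule.Quotient.mk (b ⊗ₜ[ℤ] m) : Induced φ M) = op b • inducedUnit φ M m := by
  change _ = op b • (Submodule.Quotient.mk ((1 : B) ⊗ₜ[ℤ] m) : Induced φ M)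
  rw [← Submodule.Quotient.mk_smul, TensorProduct.smul_tmul']
  simp

@[elab_as_elim]
theorem induced_induction {p : Induced φ M → Prop} (z : Induced φ M) (zero : p 0)
    (smul_unit : ∀ (b : B) (m : M), p (op b • inducedUnit φ M m))
    (add : ∀ x y, p x → p y → p (x + y)) :
    p z := by
  obtain ⟨t, rfl⟩ := Submodule.Quotient.mk_surjective _ z
  induction t using TensorProduct.induction_on with
  | zero => exact zero
  | tmul b m =>
    rw [induced_mk_eq_smul]
    exact smul_unit b m
  | add x y hx hy =>
    rw [Submodule.Quotient.mk_add]
    exact add _ _ hx hy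

section Lift

variable {Y : Type*} [AddCommGroup Y] [Module Bᵐᵒᵖ Y]

variable {φ} in
theorem induced_hom_ext {f g : Induced φ M →ₗ[Bᵐᵒᵖ] Y}
    (h : ∀ m, f (inducedUnit φ M m) = g (inducedUnit φ M m)) : f = g := by
  refine LinearMap.ext fun z => ?_
  induction z using induced_induction with
  | zero => rw [map_zero, map_zero]
  | smul_unit b m => rw [map_smul, map_smul, h]
  | add x y hx hy => rw [map_add, map_add, hx, hy]

/-- The map `M ⊗_C B → Y`, `m ⊗ b ↦ f(m) b`, of right `B`-modules extending the map `f : M → Y`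
of right `C`-modules. -/
noncomputable def inducedLift (f : M →ₛₗ[RingHom.op φ] Y) : Induced φ M →ₗ[Bᵐᵒᵖ] Y :=
  (balancing φ M).liftQ
    (TensorProduct.AlgebraTensorModule.lift
      { toFun := fun b =>
          { toFun := fun m => op b • f m
            map_add' := fun m m' => by rw [map_add, smul_add]
            map_smul' := fun n m => by
              rw [map_zsmul, smul_comm]; rfl }
        map_add' := fun b b' => LinearMap.ext fun m => add_smul (op b) (op b') (f m)
        map_smul' := fun a b => LinearMap.ext fun m => mul_smul a (op b) (f m) })
    (by
      rw [balancing, Submodule.span_le]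
      rintro _ ⟨c, b, m, rfl⟩
      rw [SetLike.mem_coe, LinearMap.mem_ker, map_sub, sub_eq_zero]
      change op (φ c * b) • f m = op b • f (op c • m)
      rw [map_smulₛₗ, smul_smul]
      rfl)

@[simp]
theorem inducedLift_unit (f : M →ₛₗ[RingHom.op φ] Y) (m : M) :
    inducedLift φ f (inducedUnit φ M m) = f m :=
  one_smul Bᵐᵒᵖ (f m)

end Lift

/-- The map `f ⊗ B : M ⊗_C B → N ⊗_C B`. -/
noncomputable def inducedMap (f : M →ₗ[Cᵐᵒᵖ] N) : Induced φ M →ₗ[Bᵐᵒᵖ] Induced φ N :=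
  inducedLift φ ((inducedUnit φ N).comp f)

@[simp]
theorem inducedMap_unit (f : M →ₗ[Cᵐᵒᵖ] N) (m : M) :
    inducedMap φ f (inducedUnit φ M m) = inducedUnit φ N (f m) :=
  inducedLift_unit _ _ _

theorem inducedMap_surjective {f : M →ₗ[Cᵐᵒᵖ] N} (hf : Function.Surjective f) :
    Function.Surjective (inducedMap φ f) := by
  rw [← LinearMap.range_eq_top, eq_top_iff]
  rintro z -
  induction z using induced_induction with
  | zero => exact zero_mem _
  | smul_unit b m =>
    obtain ⟨m, rfl⟩ := hf m
    exact ⟨op b • inducedUnit φ M m, by simp⟩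
  | add x y hx hy => exact add_mem hx hy

theorem range_inducedMap {d : P →ₗ[Cᵐᵒᵖ] N} {ε : N →ₗ[Cᵐᵒᵖ] M} (hε : Function.Surjective ε)
    (h : LinearMap.range d = LinearMap.ker ε) :
    LinearMap.range (inducedMap φ d) = LinearMap.ker (inducedMap φ ε) := by
  apply le_antisymm
  · rw [LinearMap.range_le_ker_iff]
    refine induced_hom_ext fun p => ?_
    have : ε (d p) = 0 := by
      rw [← LinearMap.mem_ker, ← h]
      exact ⟨p, rfl⟩
    simp [this]
  · let q := (LinearMap.range (inducedMap φ d)).mkQ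
    choose s hs using hε
    have key : ∀ x y, ε x = ε y → q (inducedUnit φ N x) = q (inducedUnit φ N y) := by
      intro x y hxy
      have : x - y ∈ LinearMap.range d := by
        rw [h, LinearMap.mem_ker, map_sub, hxy, sub_self]
      obtain ⟨p, hp⟩ := this
      rw [← sub_eq_zero, ← map_sub, ← map_sub, ← hp, ← LinearMap.mem_ker, Submodule.ker_mkQ]
      exact ⟨inducedUnit φ P p, by simp⟩
    let r : M →ₛₗ[RingHom.op φ] (Induced φ N ⧸ LinearMap.range (inducedMap φ d)) :=
      { toFun := fun m => q (inducedUnit φ N (s m))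
        map_add' := fun m m' => by
          rw [← map_add, ← map_add]
          exact key _ _ (by simp [hs])
        map_smul' := fun c m => by
          rw [← map_smul, ← map_smulₛₗ]
          exact key _ _ (by simp [hs]) }
    have hr : (inducedLift φ r).comp (inducedMap φ ε) = q := by
      refine induced_hom_ext fun x => ?_
      rw [LinearMap.comp_apply, inducedMap_unit, inducedLift_unit]
      exact key _ _ (hs _)
    intro z hz
    rw [LinearMap.mem_ker] at hz
    rw [← Submodule.ker_mkQ (LinearMap.range (inducedMap φ d)), LinearMap.mem_ker]
    change q z = 0
    rw [← hr, LinearMap.comp_apply, hz, map_zero]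

instance [Module.Projective Cᵐᵒᵖ P] : Module.Projective Bᵐᵒᵖ (Induced φ P) := by
  refine Module.Projective.of_lifting_property'' fun f hf => ?_
  obtain ⟨v, hv⟩ := exists_semilinear_lift f hf (inducedUnit φ P)
  refine ⟨inducedLift φ v, induced_hom_ext fun p => ?_⟩
  simpa using LinearMap.congr_fun hv p

/-- If a right `B`-module `Y` is a quotient, as a right `C`-module, of a module `Z` which extends
along `d`, then `Y` extends along `d ⊗ B`. -/
theorem ExtendsAlong.inducedMap [Module.Projective Cᵐᵒᵖ P] {d : P →ₗ[Cᵐᵒᵖ] N} {Z Y : Type*}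
    [AddCommGroup Z] [Module Cᵐᵒᵖ Z] [AddCommGroup Y] [Module Bᵐᵒᵖ Y]
    (h : ExtendsAlong d Z) (f : Z →ₛₗ[RingHom.op φ] Y) (hf : Function.Surjective f) :
    ExtendsAlong (TauRigidity.inducedMap φ d) Y := by
  intro u
  obtain ⟨u', hu'⟩ := exists_lift_of_semilinear f hf (u.comp (inducedUnit φ P))
  obtain ⟨v, hv⟩ := h u'
  refine ⟨inducedLift φ (f.comp v), induced_hom_ext fun p => ?_⟩
  rw [LinearMap.comp_apply, inducedMap_unit, inducedLift_unit]
  change f (v.comp d p) = _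
  rw [hv]
  exact LinearMap.congr_fun hu' p

end Induction

/-! ### The bimodule `D C` -/

section Dual

variable {k : Type u} [Field k] {C : Type u} [Ring C] [Algebra k C]

/-- Evaluation at `x`, on the dual of `X`. -/
def evalAt {X : Type u} [AddCommGroup X] [Module k X] (x : X) : StdDual k X →+ k where
  toFun f := (show X →ₗ[k] k from f) x
  map_zero' := rfl
  map_add' _ _ := rfl

theorem stdDual_ext {X : Type u} [AddCommGroup X] [Module k X] {f g : StdDual k X}
    (h : ∀ x, evalAt x f = evalAt x g) : f = g :=
  LinearMap.ext h

theorem evalAt_smul (a c : C) (f : StdDual k C) : evalAt c (op a • f) = evalAt (a * c) f := rfl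

theorem evalAt_leftMulDual (a c : C) (f : StdDual k C) :
    evalAt c (leftMulDual k C a f) = evalAt (c * a) f := rfl

section Finite

variable (X : Type u) [AddCommGroup X] [Module k X]

instance [Module C X] [IsScalarTower k C X] : IsScalarTower k Cᵐᵒᵖ (StdDual k X) :=
  ⟨fun r c f => LinearMap.ext fun x => by
    change (show X →ₗ[k] k from f) ((r • unop c) • x) = r • (show X →ₗ[k] k from f) (unop c • x)
    rw [smul_assoc, map_smul]⟩

instance [Module.Finite k X] : Module.Finite k (StdDual k X) :=
  inferInstanceAs (Module.Finite k (X →ₗ[k] k))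

instance [Module C X] [IsScalarTower k C X] [Module.Finite k X] :
    Module.Finite Cᵐᵒᵖ (StdDual k X) :=
  Module.Finite.of_restrictScalars_finite k _ _

end Finite

/-- Every endomorphism of the right module `D C` is a left multiplication. -/
theorem exists_eq_leftMulDual [FiniteDimensional k C] (f : StdDual k C →ₗ[Cᵐᵒᵖ] StdDual k C) :
    ∃ c, f = leftMulDual k C c := by
  let ξ : Module.Dual k (Module.Dual k C) :=
    { toFun := fun g => evalAt 1 (f g)
      map_add' := fun g g' => by
        rw [← map_add]
        exact congrArg (evalAt 1) (map_add f g g')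
      map_smul' := fun r g => by
        have h : f (r • g : StdDual k C) = r • f g := LinearMap.map_smul_of_tower f r g
        exact congrArg (evalAt 1) h }
  obtain ⟨c, hc⟩ := (Module.evalEquiv k C).surjective ξ
  have hc' : ∀ g : StdDual k C, evalAt 1 (f g) = evalAt c g := fun g =>
    (LinearMap.congr_fun hc g).symm
  refine ⟨c, LinearMap.ext fun g => stdDual_ext fun x => ?_⟩
  rw [evalAt_leftMulDual, ← evalAt_smul, ← hc', map_smul, evalAt_smul, mul_one]

variable (k) in
/-- Every finitely generated module embeds into a finite power of `D C`. -/
theorem exists_injective_to_dual [FiniteDimensional k C] (N : Type u) [AddCommGroup N]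
    [Module Cᵐᵒᵖ N] [Module.Finite Cᵐᵒᵖ N] :
    ∃ (n : ℕ) (f : N →ₗ[Cᵐᵒᵖ] (Fin n → StdDual k C)), Function.Injective f := by
  let _ : Module k N := Module.compHom N (algebraMap k Cᵐᵒᵖ)
  have : IsScalarTower k Cᵐᵒᵖ N := ⟨fun r a y => by
    rw [Algebra.smul_def, mul_smul]; rfl⟩
  have : Module.Finite k N := Module.Finite.trans Cᵐᵒᵖ N
  let b := Module.finBasis k N
  refine ⟨_, LinearMap.pi fun i =>
    { toFun := fun y =>
        show C →ₗ[k] k from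
        { toFun := fun c => b.coord i (op c • y)
          map_add' := fun c c' => by rw [MulOpposite.op_add, add_smul, map_add]
          map_smul' := fun r c => by rw [op_smul, smul_assoc, map_smul]; rfl }
      map_add' := fun y z => stdDual_ext fun c => by
        change b.coord i _ = b.coord i _ + b.coord i _
        rw [smul_add, map_add]
      map_smul' := fun a y => stdDual_ext fun c => by
        change b.coord i _ = b.coord i (op (unop a * c) • y)
        rw [smul_smul]
        rfl }, fun y z hyz => ?_⟩
  refine b.ext_elem fun i => ?_
  have h := congrArg (evalAt (1 : C)) (congrFun hyz i)
  change b.coord i (op 1 • y) = b.coord i (op 1 • z) at h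
  rwa [op_one, one_smul, one_smul] at h

end Dual

/-! ### Vanishing of `Hom_C(Ext²_C(DC, C), N)` -/

section Vanishing

theorem hasProjectiveDimensionLT_of_globalDimension_le {C : Type u} [Ring C] {n : ℕ}
    (hC : globalDimension C ≤ n) (V : ModuleCat.{u} Cᵐᵒᵖ) [Module.Finite Cᵐᵒᵖ V] :
    HasProjectiveDimensionLT V (n + 1) := by
  refine (projectiveDimension_le_iff V n).1 ?_
  exact (le_iSup₂_of_le (f := fun (X : ModuleCat.{u} Cᵐᵒᵖ) (_ : Module.Finite Cᵐᵒᵖ X) =>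
    projectiveDimension X) V ‹_› le_rfl).trans hC

theorem shortExact_mkQ {R : Type u} [Ring R] {N I : Type u} [AddCommGroup N] [Module R N]
    [AddCommGroup I] [Module R I] {f : N →ₗ[R] I} (hf : Function.Injective f) :
    (ShortComplex.mk (ModuleCat.ofHom f) (ModuleCat.ofHom (LinearMap.range f).mkQ)
      (by ext x; simp)).ShortExact :=
  ModuleCat.shortComplex_shortExact _
    (by
      intro x
      change (LinearMap.range f).mkQ x = 0 ↔ x ∈ Set.range f
      rw [← LinearMap.mem_ker, Submodule.ker_mkQ]
      rfl) hf
    (Submodule.mkQ_surjective _)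

/-- If `Ext^n(N, Y) = 0`, then `Ext^n(J, Y) → Ext^n(I, Y)` is surjective for a copresentation
`0 → N → I → J` by powers of `D C`, provided `n` is at least the global dimension. -/
theorem exists_copresentation {k : Type u} [Field k] {C : Type u} [Ring C] [Algebra k C]
    [FiniteDimensional k C] {n : ℕ} (hC : globalDimension C ≤ n) (N : Type u) [AddCommGroup N]
    [Module Cᵐᵒᵖ N] [Module.Finite Cᵐᵒᵖ N] (Y : ModuleCat.{u} Cᵐᵒᵖ)
    (hN : ∀ e : Abelian.Ext (ModuleCat.of Cᵐᵒᵖ N) Y n, e = 0) :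
    ∃ (p q : ℕ) (a : N →ₗ[Cᵐᵒᵖ] (Fin p → StdDual k C))
      (g : (Fin p → StdDual k C) →ₗ[Cᵐᵒᵖ] (Fin q → StdDual k C)),
      Function.Injective a ∧ g.comp a = 0 ∧
      ∀ x : Abelian.Ext (ModuleCat.of Cᵐᵒᵖ (Fin p → StdDual k C)) Y n,
        ∃ z : Abelian.Ext (ModuleCat.of Cᵐᵒᵖ (Fin q → StdDual k C)) Y n,
          (Abelian.Ext.mk₀ (ModuleCat.ofHom g)).comp z (zero_add n) = x := by
  obtain ⟨p, a, ha⟩ := exists_injective_to_dual k (C := C) N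
  obtain ⟨q, b, hb⟩ := exists_injective_to_dual k (C := C)
    ((Fin p → StdDual k C) ⧸ LinearMap.range a)
  refine ⟨p, q, a, b.comp (LinearMap.range a).mkQ, ha, ?_, fun x => ?_⟩
  · ext1 y
    have : (LinearMap.range a).mkQ (a y) = 0 :=
      (Submodule.Quotient.mk_eq_zero _).2 ⟨y, rfl⟩
    simp only [LinearMap.comp_apply, this, map_zero, LinearMap.zero_apply]
  · obtain ⟨y, hy⟩ := Abelian.Ext.contravariant_sequence_exact₂ (shortExact_mkQ ha) Y x (hN _)
    have := hasProjectiveDimensionLT_of_globalDimension_le hC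
      (ModuleCat.of Cᵐᵒᵖ ((Fin q → StdDual k C) ⧸ LinearMap.range b))
    obtain ⟨z, hz⟩ := Abelian.Ext.contravariant_sequence_exact₁ (shortExact_mkQ hb) Y y
      (add_comm 1 n) (Abelian.Ext.eq_zero_of_hasProjectiveDimensionLT
        (X := ModuleCat.of Cᵐᵒᵖ ((Fin q → StdDual k C) ⧸ LinearMap.range b)) _ (n + 1) le_rfl)
    refine ⟨z, ?_⟩
    rw [← hy, ← hz]
    rw [ModuleCat.ofHom_comp, Abelian.Ext.mk₀_comp_mk₀_assoc]

theorem hom_relBimodule_eq_zero {k : Type u} [Field k] {C : Type u} [Ring C] [Algebra k C]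
    [FiniteDimensional k C] (hC : globalDimension C ≤ 2) {N : Type u} [AddCommGroup N]
    [Module Cᵐᵒᵖ N] [Module.Finite Cᵐᵒᵖ N]
    (hN : ∀ e : Abelian.Ext (ModuleCat.of Cᵐᵒᵖ N) (ModuleCat.of Cᵐᵒᵖ C) 2, e = 0)
    (h : RelBimodule k C →ₗ[Cᵐᵒᵖ] N) : h = 0 := by
  obtain ⟨p, q, a, g, ha, hga, hsurj⟩ :=
    exists_copresentation (k := k) (n := 2) hC N (ModuleCat.of Cᵐᵒᵖ C) hN
  let ι (j : Fin p) : StdDual k C →ₗ[Cᵐᵒᵖ] (Fin p → StdDual k C) :=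
    LinearMap.single Cᵐᵒᵖ (fun _ => StdDual k C) j
  let π (j : Fin p) : (Fin p → StdDual k C) →ₗ[Cᵐᵒᵖ] StdDual k C := LinearMap.proj j
  let ι' (l : Fin q) : StdDual k C →ₗ[Cᵐᵒᵖ] (Fin q → StdDual k C) :=
    LinearMap.single Cᵐᵒᵖ (fun _ => StdDual k C) l
  let π' (l : Fin q) : (Fin q → StdDual k C) →ₗ[Cᵐᵒᵖ] StdDual k C := LinearMap.proj l
  choose c hc using fun (l : Fin q) (j : Fin p) =>
    exists_eq_leftMulDual ((π' l).comp (g.comp (ι j)))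
  have hg : ∀ x l, g x l = ∑ j, leftMulDual k C (c l j) (x j) := by
    intro x l
    conv_lhs => rw [← Finset.univ_sum_single x]
    rw [map_sum, Finset.sum_apply]
    exact Finset.sum_congr rfl fun j _ => LinearMap.congr_fun (hc l j) (x j)
  have hgι : ∀ j, g.comp (ι j) = ∑ l, (ι' l).comp (leftMulDual k C (c l j)) := by
    intro j
    ext1 f
    funext l
    rw [LinearMap.sum_apply, Finset.sum_apply, Finset.sum_eq_single l]
    · rw [← hc]
      simp [ι', π']
    · intro m _ hm
      simp [ι', Pi.single_eq_of_ne hm.symm]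
    · simp
  have key : ∀ e j, evalAt (1 : C) (a (h e) j) = 0 := by
    intro e j
    obtain ⟨z, hz⟩ := hsurj ((Abelian.Ext.mk₀ (ModuleCat.ofHom (π j))).comp e (zero_add 2))
    let z' (l : Fin q) : RelBimodule k C :=
      (Abelian.Ext.mk₀ (ModuleCat.ofHom (ι' l))).comp z (zero_add 2)
    have h1 : ∀ j', (Abelian.Ext.mk₀ (ModuleCat.ofHom ((π j).comp (ι j')))).comp e (zero_add 2) =
        ∑ l, op (c l j') • z' l := by
      intro j'
      rw [ModuleCat.ofHom_comp, ← Abelian.Ext.mk₀_comp_mk₀_assoc, ← hz,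
        Abelian.Ext.mk₀_comp_mk₀_assoc, ← ModuleCat.ofHom_comp, hgι,
        show ∀ f : Fin q → (StdDual k C →ₗ[Cᵐᵒᵖ] (Fin q → StdDual k C)),
          ModuleCat.ofHom (∑ l, f l) = ∑ l, ModuleCat.ofHom (f l) from
          fun f => map_sum (ModuleCat.homAddEquiv (M := ModuleCat.of Cᵐᵒᵖ (StdDual k C))
            (N := ModuleCat.of Cᵐᵒᵖ (Fin q → StdDual k C))).symm f Finset.univ,
        Abelian.Ext.mk₀_sum, Abelian.Ext.sum_comp]
      refine Finset.sum_congr rfl fun l _ => ?_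
      rw [ModuleCat.ofHom_comp, ← Abelian.Ext.mk₀_comp_mk₀_assoc]
      rfl
    have h2 : ∑ l, op (c l j) • z' l = e := by
      have : (π j).comp (ι j) = LinearMap.id := LinearMap.proj_comp_single_same _ _ _
      rw [← h1, this]
      exact Abelian.Ext.mk₀_id_comp e
    have h3 : ∀ j', j' ≠ j → ∑ l, op (c l j') • z' l = 0 := by
      intro j' hj
      have : (π j).comp (ι j') = 0 := LinearMap.proj_comp_single_ne _ _ _ _ hj.symm
      rw [← h1, this]
      exact (congrArg (fun t => Abelian.Ext.comp t e (zero_add 2)) (Abelian.Ext.mk₀_zero _ _)).trans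
        (Abelian.Ext.zero_comp _ _ _ _ _)
    have h4 : evalAt (1 : C) (a (h e) j) =
        ∑ j', evalAt (1 : C) (a (h (∑ l, op (c l j') • z' l)) j') := by
      rw [Finset.sum_eq_single j, h2]
      · intro j' _ hj
        rw [h3 j' hj, map_zero, map_zero, Pi.zero_apply, map_zero]
      · simp
    rw [h4]
    simp only [map_sum, map_smul, Finset.sum_apply, Pi.smul_apply, evalAt_smul]
    rw [Finset.sum_comm]
    refine Finset.sum_eq_zero fun l _ => ?_
    have h5 : g (a (h (z' l))) l = 0 := congrFun (LinearMap.congr_fun hga (h (z' l))) l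
    rw [hg] at h5
    have h6 := congrArg (evalAt (1 : C)) h5
    rw [map_sum, map_zero] at h6
    simpa [evalAt_leftMulDual] using h6
  ext1 e
  apply ha
  rw [LinearMap.zero_apply, map_zero]
  funext j
  refine stdDual_ext fun x => ?_
  have := key (op x • e) j
  rw [map_smul, map_smul, Pi.smul_apply, evalAt_smul, mul_one] at this
  rw [this, Pi.zero_apply, map_zero]

end Vanishing

/-! ### Maps to the Auslander–Reiten translate -/

section Translate

theorem finite_dual {A : Type*} [Ring A] (P : Type*) [AddCommGroup P] [Module Aᵐᵒᵖ P]
    [Module.Finite Aᵐᵒᵖ P] [Module.Projective Aᵐᵒᵖ P] : Module.Finite A (P →ₗ[Aᵐᵒᵖ] A) := by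
  obtain ⟨n, p, φ, hp⟩ := exists_dualBasis (A := A) P
  refine Module.Finite.of_surjective (Fintype.linearCombination A φ) fun χ =>
    ⟨fun i => χ (p i), ?_⟩
  rw [Fintype.linearCombination_apply]
  exact (eq_sum_smul hp χ).symm

theorem finite_tau (k : Type u) [Field k] (A : Type u) [Ring A] [Algebra k A]
    [FiniteDimensional k A] (X : Type u) [AddCommGroup X] [Module Aᵐᵒᵖ X]
    [Module.Finite Aᵐᵒᵖ X] : Module.Finite Aᵐᵒᵖ (Tau k A X) := by
  have := isArtinianRing_op k A
  have : Module.Finite A (MinPres₁ Aᵐᵒᵖ X →ₗ[Aᵐᵒᵖ] A) := finite_dual _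
  have : Module.Finite k (Transpose k A X) := Module.Finite.trans A _
  infer_instance

theorem extendsAlong_of_hom_tau_eq_zero (k : Type u) [Field k] {A : Type u} [Ring A] [Algebra k A]
    [FiniteDimensional k A] [IsArtinianRing Aᵐᵒᵖ] {X Y : Type u} [AddCommGroup X] [Module Aᵐᵒᵖ X]
    [Module.Finite Aᵐᵒᵖ X] [AddCommGroup Y] [Module Aᵐᵒᵖ Y]
    (h : ∀ f : Y →ₗ[Aᵐᵒᵖ] Tau k A X, f = 0) : ExtendsAlong (minPresMap Aᵐᵒᵖ X) Y :=
  ExtendsAlong.of_hom_eq_zero k _ h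

theorem isTauRigid_of_extendsAlong (k : Type u) [Field k] {A : Type u} [Ring A] [Algebra k A]
    [FiniteDimensional k A] [IsArtinianRing Aᵐᵒᵖ] {X : Type u} [AddCommGroup X] [Module Aᵐᵒᵖ X]
    [Module.Finite Aᵐᵒᵖ X] (h : ExtendsAlong (minPresMap Aᵐᵒᵖ X) X) : IsTauRigid k A X :=
  fun f => h.hom_eq_zero k _ f

end Translate

/-! ### Modules induced to a trivial extension -/

section TrivialExtension

variable {C E M : Type u} [Ring C] [AddCommGroup E] [Module C E] [Module Cᵐᵒᵖ E]
  [SMulCommClass C Cᵐᵒᵖ E] [AddCommGroup M] [Module Cᵐᵒᵖ M]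

local notation "φ" => TrivSqZeroExt.inlHom C E

/-- The map `M × Eⁿ → M ⊗_C (C ⋉ E)` of right `C`-modules, `(m, e) ↦ m ⊗ 1 + ∑ sᵢ ⊗ eᵢ`. -/
noncomputable def toInduced {n : ℕ} (s : Fin n → M) :
    (M × (Fin n → E)) →ₛₗ[RingHom.op φ] Induced φ M where
  toFun x := inducedUnit φ M x.1 + ∑ i, op (TrivSqZeroExt.inr (R := C) (x.2 i)) •
    inducedUnit φ M (s i)
  map_add' x y := by
    simp only [Prod.fst_add, Prod.snd_add, Pi.add_apply, map_add, TrivSqZeroExt.inr_add,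
      MulOpposite.op_add, add_smul, Finset.sum_add_distrib]
    abel
  map_smul' c x := by
    rw [smul_add, Finset.smul_sum, Prod.smul_fst, map_smulₛₗ]
    congr 1
    refine Finset.sum_congr rfl fun i _ => ?_
    rw [smul_smul]
    congr 1
    change op (TrivSqZeroExt.inr (c • x.2 i)) =
      op (TrivSqZeroExt.inr (x.2 i) * TrivSqZeroExt.inl (unop c))
    rw [TrivSqZeroExt.inr_mul_inl, op_unop]

theorem toInduced_apply {n : ℕ} (s : Fin n → M) (x : M × (Fin n → E)) :
    toInduced s x = inducedUnit φ M x.1 +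
      ∑ i, op (TrivSqZeroExt.inr (R := C) (x.2 i)) • inducedUnit φ M (s i) := rfl

theorem toInduced_surjective {n : ℕ} {s : Fin n → M}
    (hs : Submodule.span Cᵐᵒᵖ (Set.range s) = ⊤) :
    Function.Surjective (toInduced (C := C) (E := E) s) := by
  have hunit : ∀ (c : C) (m : M), op (TrivSqZeroExt.inl c : TrivSqZeroExt C E) •
      inducedUnit φ M m = inducedUnit φ M (op c • m) := fun c m => by
    rw [map_smulₛₗ]
    rfl
  have hinr : ∀ (m : M) (e : E), op (TrivSqZeroExt.inr (R := C) e) • inducedUnit φ M m ∈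
      (toInduced (C := C) (E := E) s).toAddMonoidHom.range := by
    intro m
    have hm : m ∈ Submodule.span Cᵐᵒᵖ (Set.range s) := hs ▸ trivial
    induction hm using Submodule.span_induction with
    | mem x hx =>
      obtain ⟨i, rfl⟩ := hx
      refine fun e => ⟨(0, Pi.single i e), ?_⟩
      change toInduced s _ = _
      rw [toInduced_apply, map_zero, zero_add, Finset.sum_eq_single i]
      · simp
      · intro j _ hj
        simp [Pi.single_eq_of_ne hj]
      · simp
    | zero => simp
    | add x y _ _ hx hy =>
      intro e
      rw [map_add, smul_add]
      exact add_mem (hx e) (hy e)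
    | smul c x _ hx =>
      intro e
      obtain ⟨c, rfl⟩ := op_surjective c
      rw [← hunit, smul_smul, ← op_mul, TrivSqZeroExt.inl_mul_inr]
      exact hx _
  intro z
  change z ∈ (toInduced (C := C) (E := E) s).toAddMonoidHom.range
  induction z using induced_induction with
  | zero => exact zero_mem _
  | smul_unit b m =>
    rw [← TrivSqZeroExt.inl_fst_add_inr_snd_eq b, MulOpposite.op_add, add_smul, hunit]
    refine add_mem ⟨(op b.fst • m, 0), ?_⟩ (hinr _ _)
    change toInduced s _ = _
    simp [toInduced_apply]
  | add x y hx hy => exact add_mem hx hy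

theorem extendsAlong_induced [IsArtinianRing Cᵐᵒᵖ] [IsArtinianRing (TrivSqZeroExt C E)ᵐᵒᵖ]
    [Module.Finite Cᵐᵒᵖ M] (hM : ExtendsAlong (minPresMap Cᵐᵒᵖ M) M)
    (hE : ExtendsAlong (minPresMap Cᵐᵒᵖ M) E) :
    ExtendsAlong (minPresMap (TrivSqZeroExt C E)ᵐᵒᵖ (Induced φ M)) (Induced φ M) := by
  obtain ⟨n, s, hs⟩ := Module.Finite.exists_fin (R := Cᵐᵒᵖ) (M := M)
  have hZ : ExtendsAlong (minPresMap Cᵐᵒᵖ M) (M × (Fin n → E)) :=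
    hM.prod (ExtendsAlong.pi fun _ => hE)
  have h₀ := (projCover_isProjectiveCover Cᵐᵒᵖ M).surjective
  exact (hZ.inducedMap φ (toInduced s) (toInduced_surjective hs)).minPresMap
    (inducedMap_surjective φ h₀) (range_inducedMap φ h₀ range_minPresMap)

end TrivialExtension

end TauRigidity

theorem proposition3p3 {k : Type u} [Field k] [IsAlgClosed k]
    {C : Type u} [Ring C] [Algebra k C] [FiniteDimensional k C]
    (hC : TauRigidity.globalDimension C ≤ 2)
    (M : Type u) [AddCommGroup M] [Module Cᵐᵒᵖ M] [Module.Finite Cᵐᵒᵖ M]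
    (hM : TauRigidity.IsTauRigid k C M)
    (hpd : projectiveDimension (ModuleCat.of Cᵐᵒᵖ (TauRigidity.Tau k C M)) ≤ 1) :
    TauRigidity.IsTauRigid k (TauRigidity.RelationExtension k C)
      (TauRigidity.Induced (TrivSqZeroExt.inlHom C (TauRigidity.RelBimodule k C)) M) := by
  have := TauRigidity.isArtinianRing_op k C
  have := TauRigidity.isArtinianRing_op k (TauRigidity.RelationExtension k C)
  have : HasProjectiveDimensionLT (ModuleCat.of Cᵐᵒᵖ (TauRigidity.Tau k C M)) 2 :=
    (projectiveDimension_le_iff _ 1).1 hpd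
  have := TauRigidity.finite_tau k C M
  have hE : ∀ f : TauRigidity.RelBimodule k C →ₗ[Cᵐᵒᵖ] TauRigidity.Tau k C M, f = 0 :=
    TauRigidity.hom_relBimodule_eq_zero hC fun e => e.eq_zero_of_hasProjectiveDimensionLT 2 le_rfl
  exact TauRigidity.isTauRigid_of_extendsAlong k (TauRigidity.extendsAlong_induced
    (TauRigidity.extendsAlong_of_hom_tau_eq_zero k hM)
    (TauRigidity.extendsAlong_of_hom_tau_eq_zero k hE))
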